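/- Let \(L\subseteq K\) be algebraically closed fields of arbitrary characteristic (\(K\) plays the role of a universal field over \(L\)). For \(d\in\mathbb N\) and a tuple \(\bar u=(u_{ij})_{0\le i+j\le d}\), let \(C_{\bar u}\) be the projective plane curve of degree \(d\) defined by the form \(\sum_{0\le i+j\le d}u_{ij}X^iY^jZ^{d-(i+j)}\), with affine equation \(\sum_{0\le i+j\le d} u_{ij}x^iy^j=0\) where \(x=X/Z\), \(y=Y/Z\); it is called reduced if this form is nonzero and has no repeated factors. Given \(\bar u\) over \(L\) and a tuple \(\bar u'=(u'_{ij})_{0\le i+j\le d}\) in \(K\), let \(C_{\bar u}^{\bar u'}\) be the deformed curve \(\sum_{0\le i+j\le d}(u_{ij}+u'_{ij})X^iY^jZ^{d-(i+j)}=0\). **Lemma 4.12 (Moving Lemma for Reduced Curves).** Let \(\bar u,\bar v\) be tuples in \(L\) such that \(C_{\bar u}\) and \(C_{\bar v}\) are reduced curves, of degrees \(d\) and \(e\). Suppose that \(\bar u'\) is generic over \(L\) in the space of all degree \(d\) curves, that is, the \((d+1)(d+2)/2\) elements \(u'_{ij}\in K\), \(0\le i+j\le d\), are algebraically independent over \(L\).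 Then \(C_{\bar u}^{\bar u'}\) intersects \(C_{\bar v}\) transversally at simple points: every point \(P\in\mathbb P^2(K)\) lying on both curves is a simple point of \(C_{\bar u}^{\bar u'}\) and of \(C_{\bar v}\) (the three partial derivatives of the defining form do not all vanish at \(P\)), and the tangent lines of the two curves at \(P\) are distinct. -/

import Mathlib

noncomputable section

namespace PlaneCurve

/-- The index set of the parameter space of plane curves of degree `d`:
pairs `(i, j)` of natural numbers with `0 ≤ i + j ≤ d`. -/
abbrev Idx (d : ℕ) : Type :=
  {p : Fin (d + 1) × Fin (d + 1) // (p.1 : ℕ) + (p.2 : ℕ) ≤ d}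

/-- The form `∑ u_ij X^i Y^j Z^(d-(i+j))` of degree `d` with coefficient tuple `u`; the affine
equation `∑ u_ij x^i y^j` is recovered by setting `x = X/Z`, `y = Y/Z`. -/
def form {R : Type*} [CommRing R] (d : ℕ) (u : Idx d → R) : MvPolynomial (Fin 3) R :=
  ∑ p : Idx d, MvPolynomial.C (u p) * MvPolynomial.X 0 ^ (p.1.1 : ℕ) *
    MvPolynomial.X 1 ^ (p.1.2 : ℕ) * MvPolynomial.X 2 ^ (d - ((p.1.1 : ℕ) + (p.1.2 : ℕ)))

/-- The projective plane over `K`. -/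
abbrev Plane (K : Type*) [Field K] : Type _ := Projectivization K (Fin 3 → K)

/-- The plane projective curve is reduced: its defining form is nonzero without repeated factors
(`0` is not squarefree). -/
def IsReducedCurve {R : Type*} [CommRing R] (d : ℕ) (u : Idx d → R) : Prop :=
  Squarefree (form d u)

/-- The set of points of the projective plane on the curve `F = 0`, for a form `F`
(for a form, the condition does not depend on the representative). -/
def points {K : Type*} [Field K] (F : MvPolynomial (Fin 3) K) : Set (Plane K) :=
  {P | MvPolynomial.eval P.rep F = 0}

/-- The gradient `(F_X, F_Y, F_Z)` at a representative of `P`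
(for a form, a change of representative multiplies it by a nonzero scalar). -/
def grad {K : Type*} [Field K] (F : MvPolynomial (Fin 3) K) (P : Plane K) : Fin 3 → K :=
  fun k => MvPolynomial.eval P.rep (MvPolynomial.pderiv k F)

/-- `P` is a simple (nonsingular) point of the curve `F = 0`. -/
def IsSimplePoint {K : Type*} [Field K] (F : MvPolynomial (Fin 3) K) (P : Plane K) : Prop :=
  P ∈ points F ∧ grad F P ≠ 0

/-- The tangent line `F_X(P) X + F_Y(P) Y + F_Z(P) Z = 0` at a simple point `P` of `F = 0`, as a
set of points of the projective plane. -/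
def tangentLine {K : Type*} [Field K] (F : MvPolynomial (Fin 3) K) (P : Plane K) :
    Set (Plane K) :=
  {Q | ∑ k, grad F P k * Q.rep k = 0}

/-- The curves `F = 0` and `G = 0` intersect transversally at `P`: it is a simple point of
both, and their tangent lines at `P` are distinct. -/
def TransversalAt {K : Type*} [Field K] (F G : MvPolynomial (Fin 3) K) (P : Plane K) : Prop :=
  IsSimplePoint F P ∧ IsSimplePoint G P ∧ tangentLine F P ≠ tangentLine G P

/-- The deformation of the degree `d` curve with parameter `u` over `L` by the tuple `u'` of
elements of an extension field `K`: the curve with equation `∑ (u_ij + u'_ij) x^i y^j = 0`. -/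
def deformedForm {L K : Type*} [Field L] [Field K] [Algebra L K] (d : ℕ)
    (u : Idx d → L) (u' : Idx d → K) : MvPolynomial (Fin 3) K :=
  form d (fun p => algebraMap L K (u p) + u' p)

/-- The tuple `u'` of elements of `K` is a generic point over `L` of the affine space of all
degree `d` curves: its coordinates are algebraically independent over `L`. -/
def IsGeneric (L : Type*) {K : Type*} [Field L] [Field K] [Algebra L K] {d : ℕ}
    (u' : Idx d → K) : Prop :=
  AlgebraicIndependent L u'

end PlaneCurve

end

/-!
The proof is a count of transcendence degrees on affine cones. Write `a` for the coefficients
of the deformed form `F`, which are again algebraically independent over `L`, write `G` for the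
fixed form, and suppose that the curves meet at `P` and that all the `2 × 2` minors of the gradients
of `F` and `G` vanish at `P`; a nonzero minor gives transversality
(`transversalAt_of_minor_ne_zero`). Replace `P` by the point `x = t • P` of the cone, with `t`
transcendental over `K`. Some coordinate `x k` is then transcendental over `K`, so the `N + 1`
elements `x k` and `a` are algebraically independent over `L`, where `N` is the number of
coefficients.

* If `G` is singular at `x`, the coordinates of `x` are algebraic over `L(x k)`: otherwise the ideal
  of `x` in `L[X, Y, Z]` would be generated by an irreducible factor of `G`, and a squarefree form
  over a perfect field has some partial derivative outside that ideal
  (`exists_aeval_pderiv_ne_zero_of_squarefree`). The equation `F(x) = 0` is a nontrivial linear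
  relation for `a` over `L(x)`, so the transcendence degree is at most `N`
  (`sum_mul_ne_zero`).
* If `G` is nonsingular at `x`, the transcendence degree of `L(x)` is still at most two because
  `G(x) = 0`, and now `a` satisfies two independent linear relations over `L(x)`, namely `F(x) = 0`
  and the vanishing of a minor of the gradients, so the transcendence degree is again at most `N`
  (`sum_mul_ne_zero_of_sum_mul_eq_zero`). Independence of the relations is seen on the coefficients
  of `X k ^ d` and `X k ^ (d - 1) * X j`.

Both cases contradict the independence of `x k` and `a`. Separability plays no role in the second
case, so the argument is uniform in the characteristic.
-/

/-! ### Ideals of relations and squarefree polynomials -/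

namespace Polynomial

/-- By Gauss's lemma, an irreducible `P` stays irreducible over the fraction field of `R`, where a
Bézout relation with a `Q` that it does not divide would contradict the common root `y`. -/
theorem dvd_of_irreducible_of_eval₂_eq_zero {R A : Type*} [CommRing R] [IsDomain R]
    [UniqueFactorizationMonoid R] [Field A] {f : R →+* A} (hf : Function.Injective f) {y : A}
    {P Q : Polynomial R} (hP : Irreducible P) (hPy : P.eval₂ f y = 0) (hQy : Q.eval₂ f y = 0) :
    P ∣ Q := by
  classical
  let _ : NormalizedGCDMonoid R := Nonempty.some inferInstance
  have hdeg : P.natDegree ≠ 0 := by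
    intro h
    obtain ⟨c, rfl⟩ := natDegree_eq_zero.mp h
    rw [eval₂_C, map_eq_zero_iff f hf] at hPy
    exact hP.ne_zero (by rw [hPy, map_zero])
  have hprim := hP.isPrimitive hdeg
  let g : FractionRing R →+* A := IsFractionRing.lift hf
  have hg : g.comp (algebraMap R (FractionRing R)) = f := IsLocalization.lift_comp _
  have hP' := (hprim.irreducible_iff_irreducible_map_fraction_map (K := FractionRing R)).mp hP
  by_contra hdvd
  have hcop := hP'.coprime_iff_not_dvd.mpr
    (mt (hprim.dvd_of_fraction_map_dvd_fraction_map (K := FractionRing R)) hdvd)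
  obtain ⟨a, b, hab⟩ := hcop
  have := congrArg (eval₂ g y) hab
  simp [eval₂_map, hg, hPy, hQy] at this

end Polynomial

namespace MvPolynomial

variable {σ L A : Type*} [Field L]

theorem exists_irreducible_dvd_of_aeval_eq_zero [CommRing A] [IsDomain A] [Algebra L A]
    {x : σ → A} {G : MvPolynomial σ L} (hG : G ≠ 0) (hGx : aeval x G = 0) :
    ∃ H, Irreducible H ∧ H ∣ G ∧ aeval x H = 0 := by
  induction G using WfDvdMonoid.induction_on_irreducible with
  | zero => exact absurd rfl hG
  | unit u hu => exact absurd hGx (hu.map (aeval x)).ne_zero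
  | mul a i ha hi ih =>
    rw [map_mul, mul_eq_zero] at hGx
    rcases hGx with h | h
    · exact ⟨i, hi, dvd_mul_right _ _, h⟩
    · obtain ⟨H, h1, h2, h3⟩ := ih ha h
      exact ⟨H, h1, h2.mul_left _, h3⟩

/-- If all coordinates of `x` but one are algebraically independent, then an irreducible relation `H`
of `x` generates the ideal of all its relations. -/
theorem dvd_of_irreducible_of_aeval_eq_zero [Field A] [Algebra L A] {x : σ → A} {m : σ}
    (hx : AlgebraicIndepOn L x {m}ᶜ) {H Q : MvPolynomial σ L} (hH : Irreducible H)
    (hHx : aeval x H = 0) (hQx : aeval x Q = 0) : H ∣ Q := by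
  classical
  let e : MvPolynomial σ L ≃ₐ[L] Polynomial (MvPolynomial {j // j ≠ m} L) :=
    (renameEquiv L (Equiv.optionSubtypeNe m).symm).trans (optionEquivLeft L _)
  let f : MvPolynomial {j // j ≠ m} L →ₐ[L] A := aeval fun j => x j
  have hf : Function.Injective f := hx
  have key (F : MvPolynomial σ L) : (e F).eval₂ (f : _ →+* A) (x m) = aeval x F := by
    induction F using MvPolynomial.induction_on with
    | C a => simp [e, f]
    | add p q hp hq => simp [hp, hq, Polynomial.eval₂_add]
    | mul_X p i hp =>
      rw [map_mul, Polynomial.eval₂_mul, hp, map_mul, aeval_X]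
      congr 1
      by_cases h : i = m
      · subst h; simp [e]
      · simp [e, f, Equiv.optionSubtypeNe_symm_of_ne h]
  rw [← map_dvd_iff e]
  exact Polynomial.dvd_of_irreducible_of_eval₂_eq_zero (f := (f : _ →+* A)) hf (hH.map e)
    ((key H).trans hHx) ((key Q).trans hQx)

theorem totalDegree_pderiv_lt {R : Type*} [CommSemiring R] {F : MvPolynomial σ R} {i : σ}
    (h : pderiv i F ≠ 0) : (pderiv i F).totalDegree < F.totalDegree := by
  classical
  obtain ⟨m, hm, hdeg⟩ := Finset.exists_mem_eq_sup _ (support_nonempty.mpr h)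
    fun s : σ →₀ ℕ => s.sum fun _ e => e
  rw [totalDegree, hdeg]
  have hm' : m + Finsupp.single i 1 ∈ F.support := by
    rw [mem_support_iff, coeff_pderiv] at *
    exact left_ne_zero_of_mul hm
  refine lt_of_lt_of_le ?_ (le_totalDegree hm')
  rw [Finsupp.sum_add_index' (by simp) (by simp)]
  simp

/-- Over a perfect field of characteristic `p`, a polynomial all of whose partial derivatives vanish
is a constant if `p = 0` and a `p`-th power otherwise, so it is not irreducible. -/
theorem exists_pderiv_ne_zero_of_irreducible [PerfectField L] {H : MvPolynomial σ L}
    (hH : Irreducible H) : ∃ i, pderiv i H ≠ 0 := by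
  classical
  by_contra! hder
  obtain ⟨p, hp⟩ := CharP.exists L
  have hdvd : ∀ s ∈ H.support, ∀ i, p ∣ s i := by
    intro s hs i
    by_cases hsi : s i = 0
    · simp [hsi]
    have h := coeff_pderiv (i := i) H (s - Finsupp.single i 1)
    -- The coefficient of `∂H/∂X i` at `s - e i` is `s i` times that of `H` at `s`.
    have hs' : s - Finsupp.single i 1 + Finsupp.single i 1 = s := by
      ext j
      by_cases hj : j = i
      · subst hj; simp; omega
      · simp [Finsupp.single_eq_of_ne hj]
    rw [hder, coeff_zero, hs', eq_comm, mul_eq_zero, or_iff_right (mem_support_iff.mp hs)] at h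
    rw [← CharP.cast_eq_zero_iff L p]
    have : s i = (s - (Finsupp.single i 1 : σ →₀ ℕ)) i + 1 := by simp; omega
    rw [this]
    exact_mod_cast h
  rcases CharP.char_is_prime_or_zero L p with hprime | rfl
  · have := Fact.mk hprime
    have : ExpChar L p := .prime hprime
    have hroot : ∀ c : L, ∃ b, b ^ p = c := fun c => by
      obtain ⟨b, hb⟩ := surjective_frobenius L p c
      exact ⟨b, hb⟩
    choose r hr using hroot
    have hpow : H = (∑ s ∈ H.support,
        monomial (s.mapRange (· / p) (Nat.zero_div p)) (r (coeff s H))) ^ p := by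
      rw [sum_pow_char]
      conv_lhs => rw [H.as_sum]
      refine Finset.sum_congr rfl fun s hs => ?_
      rw [monomial_pow, hr]
      refine congrArg (fun m => monomial m (coeff s H)) (Finsupp.ext fun i => ?_)
      simp [Nat.mul_div_cancel' (hdvd s hs i)]
    rw [hpow] at hH
    exact not_irreducible_pow hprime.one_lt.ne' hH
  · have hC : H = C (coeff 0 H) := by
      ext s
      rw [coeff_C]
      split_ifs with h
      · rw [h]
      · by_contra hs
        refine h (Finsupp.ext fun i => ?_)
        simpa using (Nat.eq_zero_of_zero_dvd (hdvd s (mem_support_iff.mpr hs) i)).symm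
    have h0 : coeff 0 H ≠ 0 := fun h => hH.ne_zero (by rw [hC, h, map_zero])
    exact hH.not_isUnit (hC ▸ (isUnit_iff_ne_zero.mpr h0).map C)

/-- A squarefree polynomial is nonsingular at a generic point of the hypersurface that it defines. -/
theorem exists_aeval_pderiv_ne_zero_of_squarefree [PerfectField L] [Field A] [Algebra L A]
    {x : σ → A} {m : σ} (hx : AlgebraicIndepOn L x {m}ᶜ) {G : MvPolynomial σ L}
    (hG : Squarefree G) (hGx : aeval x G = 0) : ∃ i, aeval x (pderiv i G) ≠ 0 := by
  by_contra! hder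
  obtain ⟨H, hH, ⟨Q, rfl⟩, hHx⟩ := exists_irreducible_dvd_of_aeval_eq_zero hG.ne_zero hGx
  by_cases hQx : aeval x Q = 0
  · exact hH.not_isUnit (hG H (mul_dvd_mul_left H
      (dvd_of_irreducible_of_aeval_eq_zero hx hH hHx hQx)))
  obtain ⟨i, hi⟩ := exists_pderiv_ne_zero_of_irreducible hH
  have hHi : aeval x (pderiv i H) = 0 := by
    have := hder i
    rw [pderiv_mul, map_add, map_mul, map_mul, hHx, zero_mul, add_zero] at this
    exact (mul_eq_zero.mp this).resolve_right hQx
  obtain ⟨R, hR⟩ := dvd_of_irreducible_of_aeval_eq_zero hx hH hHx hHi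
  have hlt := totalDegree_pderiv_lt hi
  rw [hR] at hi hlt
  rw [totalDegree_mul_of_isDomain hH.ne_zero (right_ne_zero_of_mul hi)] at hlt
  omega

end MvPolynomial

/-! ### Algebraic dependence -/

namespace PlaneCurve

open MvPolynomial

section AlgebraicDependence

variable {L E : Type*} [Field L] [Field E] [Algebra L E]

variable (L) in
/-- The elements of `E` that are algebraic over the `L`-algebra generated by `S`, as an
`L`-subalgebra of `E`. This is the closure of `S` in the algebraic independence matroid. -/
def algClosureOf (S : Set E) : Subalgebra L E :=
  (Subalgebra.algebraicClosure (Algebra.adjoin L S) E).restrictScalars L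

theorem mem_algClosureOf {S : Set E} {y : E} :
    y ∈ algClosureOf L S ↔ IsAlgebraic (Algebra.adjoin L S) y := Iff.rfl

theorem coe_algClosureOf (S : Set E) :
    (algClosureOf L S : Set E) = (AlgebraicIndependent.matroid L E).closure S :=
  AlgebraicIndependent.matroid_closure_eq.symm

theorem subset_algClosureOf (S : Set E) : S ⊆ algClosureOf L S := by
  rw [coe_algClosureOf]
  exact Matroid.subset_closure _ _

theorem algClosureOf_le {S T : Set E} (h : S ⊆ algClosureOf L T) :
    algClosureOf L S ≤ algClosureOf L T := by
  rw [coe_algClosureOf] at h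
  rw [← SetLike.coe_subset_coe, coe_algClosureOf, coe_algClosureOf]
  exact Matroid.closure_subset_closure_of_subset_closure h

theorem algClosureOf_mono {S T : Set E} (h : S ⊆ T) : algClosureOf L S ≤ algClosureOf L T :=
  algClosureOf_le (h.trans (subset_algClosureOf T))

/-- The exchange property of algebraic dependence. -/
theorem mem_algClosureOf_insert_comm {S : Set E} {y z : E} (h : y ∈ algClosureOf L (insert z S))
    (hy : y ∉ algClosureOf L S) : z ∈ algClosureOf L (insert y S) := by
  simp only [← SetLike.mem_coe, coe_algClosureOf] at *
  exact (Matroid.closure_exchange ⟨h, hy⟩).1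

theorem notMem_algClosureOf_image_compl {ι : Type*} {w : ι → E} (hw : AlgebraicIndependent L w)
    (i : ι) : w i ∉ algClosureOf L (w '' {i}ᶜ) := by
  exact hw.transcendental_adjoin (i := i) (s := {i}ᶜ) (by simp)

theorem aeval_mem_algClosureOf {σ : Type*} {x : σ → E} {S : Set E}
    (hx : ∀ i, x i ∈ algClosureOf L S) (F : MvPolynomial σ L) :
    aeval x F ∈ algClosureOf L S := by
  have h : aeval x F ∈ (aeval (R := L) x).range := ⟨F, rfl⟩
  rw [aeval_range] at h
  exact Algebra.adjoin_le (Set.range_subset_iff.mpr hx) h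

theorem mem_algClosureOf_of_sum_eq_zero {ι : Type*} [Fintype ι] {S : Set E} {c a : ι → E} {q : ι}
    (hc : ∀ p, c p ∈ algClosureOf L S) (hq : c q ≠ 0)
    (ha : ∀ p, p ≠ q → c p ≠ 0 → a p ∈ algClosureOf L S) (h : ∑ p, c p * a p = 0) :
    a q ∈ algClosureOf L S := by
  classical
  rw [← Finset.add_sum_erase _ _ (Finset.mem_univ q), add_eq_zero_iff_eq_neg] at h
  have hmem : c q * a q ∈ algClosureOf L S := by
    rw [h]
    refine neg_mem (sum_mem fun p hp => ?_)
    by_cases hcp : c p = 0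
    · rw [hcp, zero_mul]; exact zero_mem _
    · exact mul_mem (hc p) (ha p (Finset.ne_of_mem_erase hp) hcp)
  have hinv : (c q)⁻¹ ∈ algClosureOf L S := (mem_algClosureOf.mp (hc q)).inv
  simpa [hq] using mul_mem hinv hmem

/-- Elements `a` independent of `y` satisfy no nontrivial linear relation with coefficients algebraic
over `L(y)`. -/
theorem sum_mul_ne_zero {ι : Type*} [Fintype ι] {y : E} {a c : ι → E}
    (hw : AlgebraicIndependent L (Sum.elim (fun _ : Unit => y) a)) {q : ι}
    (hc : ∀ p, c p ∈ algClosureOf L {y}) (hq : c q ≠ 0) : ∑ p, c p * a p ≠ 0 := by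
  intro h
  refine notMem_algClosureOf_image_compl hw (.inr q) ?_
  refine mem_algClosureOf_of_sum_eq_zero (a := a) (fun p => algClosureOf_mono ?_ (hc p)) hq
    (fun p hp _ => subset_algClosureOf _ ⟨.inr p, by simpa using hp, rfl⟩) h
  rintro _ rfl
  exact ⟨.inl (), by simp, rfl⟩

/-- Elements `a` independent of `y` do not satisfy two independent linear relations with coefficients
algebraic over `L(y, z)`. The `2 × 2` minor at `q`, `q'` witnessing independence of the relations is
taken in triangular form, `c' q = 0`. -/
theorem sum_mul_ne_zero_of_sum_mul_eq_zero {ι : Type*} [Fintype ι] {y z : E} {a c c' : ι → E}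
    (hw : AlgebraicIndependent L (Sum.elim (fun _ : Unit => y) a)) {q q' : ι}
    (hc : ∀ p, c p ∈ algClosureOf L {y, z}) (hc' : ∀ p, c' p ∈ algClosureOf L {y, z})
    (hq : c q ≠ 0) (hq' : c' q' ≠ 0) (h0 : c' q = 0) (h : ∑ p, c p * a p = 0) :
    ∑ p, c' p * a p ≠ 0 := by
  intro h'
  have hqq : q' ≠ q := fun e => hq' (e ▸ h0)
  let w := Sum.elim (fun _ : Unit => y) a
  let S : Set E := w '' {.inr q, .inr q'}ᶜ
  have hyz : ({y, z} : Set E) ⊆ insert z S := by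
    rintro _ (rfl | rfl)
    · exact .inr ⟨.inl (), by simp, rfl⟩
    · exact .inl rfl
  have hS : ∀ p, p ≠ q → p ≠ q' → a p ∈ insert z S := fun p h1 h2 =>
    .inr ⟨.inr p, by simp [h1, h2], rfl⟩
  -- Since `c' q = 0`, the second relation expresses `a q'` without `a q`; the first then gives `a q`.
  have hmem' : a q' ∈ algClosureOf L (insert z S) :=
    mem_algClosureOf_of_sum_eq_zero (fun p => algClosureOf_mono hyz (hc' p)) hq'
      (fun p hp hp0 => subset_algClosureOf _ (hS p (fun e => hp0 (e ▸ h0)) hp)) h'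
  have hmem : a q ∈ algClosureOf L (insert z S) := by
    refine mem_algClosureOf_of_sum_eq_zero (fun p => algClosureOf_mono hyz (hc p)) hq
      (fun p hp _ => ?_) h
    by_cases hp' : p = q'
    · exact hp' ▸ hmem'
    · exact subset_algClosureOf _ (hS p hp hp')
  have hnot : a q' ∉ algClosureOf L S := fun hm =>
    notMem_algClosureOf_image_compl hw (.inr q')
      (algClosureOf_mono (Set.image_mono fun o ho => by simp_all) hm)
  -- As `a q'` does not depend on `S`, it can be exchanged with `z`.
  have hz := mem_algClosureOf_insert_comm hmem' hnot
  have hsub : insert (a q') S ⊆ w '' {.inr q}ᶜ := by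
    rintro _ (rfl | ⟨o, ho, rfl⟩)
    · exact ⟨.inr q', by simpa using hqq, rfl⟩
    · exact ⟨o, by simp_all, rfl⟩
  refine notMem_algClosureOf_image_compl hw (.inr q) (algClosureOf_le ?_ hmem)
  rintro o (rfl | ho)
  · exact algClosureOf_mono hsub hz
  · exact subset_algClosureOf _ (hsub (.inr ho))

theorem algebraicIndepOn_singleton_of_transcendental {σ : Type*} {x : σ → E} {k : σ}
    (hk : Transcendental L (x k)) : AlgebraicIndepOn L x {k} :=
  (algebraicIndependent_singleton_iff (⟨k, rfl⟩ : ({k} : Set σ))).mpr hk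

theorem algebraicIndepOn_insert {σ : Type*} {x : σ → E} {s : Set σ} {j : σ}
    (hs : AlgebraicIndepOn L x s) (hj : x j ∉ algClosureOf L (x '' s)) :
    AlgebraicIndepOn L x (insert j s) :=
  hs.insert hj

theorem exists_third {k m : Fin 3} (h : m ≠ k) :
    ∃ j, j ≠ k ∧ j ≠ m ∧ ∀ i, i = k ∨ i = j ∨ i = m := by
  revert k m; decide

/-- If no two of the three coordinates of `x` are independent, all are algebraic over `L(x k)` for a
transcendental coordinate `x k`. -/
theorem mem_algClosureOf_singleton {x : Fin 3 → E} {k : Fin 3} (hk : Transcendental L (x k))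
    (h : ∀ m, ¬ AlgebraicIndepOn L x {m}ᶜ) (i : Fin 3) : x i ∈ algClosureOf L {x k} := by
  by_contra hi
  have hik : i ≠ k := by
    rintro rfl
    exact hi (subset_algClosureOf _ rfl)
  obtain ⟨m, hmk, hmi, hall⟩ := exists_third hik
  refine h m ?_
  have hset : ({m}ᶜ : Set (Fin 3)) = insert i {k} := by
    ext n
    rcases hall n with rfl | rfl | rfl <;> simp [*, Ne.symm]
  rw [hset]
  exact algebraicIndepOn_insert (algebraicIndepOn_singleton_of_transcendental hk) (by simpa)

/-- A relation between the three coordinates of `x` makes them algebraic over `L(x k, z)` for some `z`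
(one of the other two coordinates). -/
theorem exists_mem_algClosureOf_pair {x : Fin 3 → E} {k : Fin 3} (hk : Transcendental L (x k))
    (h : ¬ AlgebraicIndependent L x) : ∃ z, ∀ i, x i ∈ algClosureOf L {x k, z} := by
  obtain ⟨j, hjk⟩ : ∃ j, j ≠ k := exists_ne k
  obtain ⟨m, hmk, hmj, hall⟩ := exists_third hjk
  by_cases hj : x j ∈ algClosureOf L {x k}
  · refine ⟨x m, fun i => ?_⟩
    rcases hall i with rfl | rfl | rfl
    · exact subset_algClosureOf _ (by simp)
    · exact subset_algClosureOf _ (by simp)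
    · exact algClosureOf_mono (by simp) hj
  · refine ⟨x j, fun i => ?_⟩
    rcases hall i with rfl | rfl | rfl
    · exact subset_algClosureOf _ (by simp)
    · by_contra hm
      apply h
      have h2 := algebraicIndepOn_insert (j := j)
        (algebraicIndepOn_singleton_of_transcendental hk) (by simpa using hj)
      have h3 := algebraicIndepOn_insert (j := i) h2 (by
        rwa [Set.image_insert_eq, Set.image_singleton, Set.pair_comm])
      have hset : insert i (insert j {k}) = (Set.univ : Set (Fin 3)) := by
        ext n
        rcases hall n with rfl | rfl | rfl <;> simp
      rw [hset] at h3
      exact h3.comp (fun n => ⟨n, trivial⟩) fun _ _ e => congrArg Subtype.val e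
    · exact subset_algClosureOf _ (by simp)

end AlgebraicDependence

/-! ### Forms and their coefficients -/

section Forms

/-- The monomial `X^i Y^j Z^(d-(i+j))` of degree `d` with index `p = (i, j)`. -/
noncomputable def basisMonomial (R : Type*) [CommRing R] {d : ℕ} (p : Idx d) :
    MvPolynomial (Fin 3) R :=
  X 0 ^ (p.1.1 : ℕ) * X 1 ^ (p.1.2 : ℕ) * X 2 ^ (d - ((p.1.1 : ℕ) + (p.1.2 : ℕ)))

variable {R : Type*} [CommRing R] {d : ℕ}

theorem form_eq_sum (u : Idx d → R) : form d u = ∑ p, C (u p) * basisMonomial R p := by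
  simp only [form, basisMonomial, mul_assoc]

theorem isHomogeneous_form (u : Idx d → R) : (form d u).IsHomogeneous d := by
  rw [form_eq_sum]
  refine IsHomogeneous.sum _ _ _ fun p _ => ?_
  have h := (isHomogeneous_C (Fin 3) (u p)).mul
    (((isHomogeneous_X_pow (R := R) (0 : Fin 3) p.1.1).mul (isHomogeneous_X_pow 1 p.1.2)).mul
      (isHomogeneous_X_pow 2 (d - ((p.1.1 : ℕ) + (p.1.2 : ℕ)))))
  have hd : 0 + (p.1.1 + p.1.2 + (d - ((p.1.1 : ℕ) + (p.1.2 : ℕ)))) = d := by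
    have := p.2; omega
  rwa [hd] at h

theorem exists_basisMonomial_eq {n : Fin 3 → ℕ} (h : n 0 + n 1 + n 2 = d) :
    ∃ p : Idx d, basisMonomial R p = X 0 ^ n 0 * X 1 ^ n 1 * X 2 ^ n 2 := by
  refine ⟨⟨(⟨n 0, by omega⟩, ⟨n 1, by omega⟩), ?_⟩, ?_⟩
  · change n 0 + n 1 ≤ d
    omega
  · rw [show n 2 = d - (n 0 + n 1) by omega]
    rfl

theorem exists_basisMonomial_eq_X_pow (k : Fin 3) : ∃ p : Idx d, basisMonomial R p = X k ^ d := by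
  obtain ⟨p, hp⟩ := exists_basisMonomial_eq (R := R) (d := d) (n := Pi.single k d)
    (by fin_cases k <;> simp)
  refine ⟨p, hp.trans ?_⟩
  fin_cases k <;> simp

theorem exists_basisMonomial_eq_X_pow_mul_X {k j : Fin 3} (hkj : j ≠ k) (hd : d ≠ 0) :
    ∃ p : Idx d, basisMonomial R p = X k ^ (d - 1) * X j := by
  obtain ⟨e, rfl⟩ := Nat.exists_eq_succ_of_ne_zero hd
  obtain ⟨p, hp⟩ := exists_basisMonomial_eq (R := R) (d := e + 1)
    (n := Pi.single k e + Pi.single j 1) (by fin_cases k <;> fin_cases j <;> simp_all <;> omega)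
  refine ⟨p, hp.trans ?_⟩
  fin_cases k <;> fin_cases j <;> simp_all <;> ring

theorem map_basisMonomial {S : Type*} [CommRing S] (f : R →+* S) (p : Idx d) :
    map f (basisMonomial R p) = basisMonomial S p := by
  simp [basisMonomial]

theorem map_form {S : Type*} [CommRing S] (f : R →+* S) (u : Idx d → R) :
    map f (form d u) = form d (f ∘ u) := by
  simp [form_eq_sum, map_basisMonomial]

variable {L A : Type*} [Field L] [Field A] [Algebra L A]

/-- The value of a form is linear in its coefficients, with multipliers that are values of
polynomials over `L`. -/
theorem eval_form (x : Fin 3 → A) (a : Idx d → A) :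
    eval x (form d a) = ∑ p, aeval x (basisMonomial L p) * a p := by
  rw [form_eq_sum, map_sum]
  refine Finset.sum_congr rfl fun p _ => ?_
  rw [map_mul, eval_C, mul_comm, ← map_basisMonomial (algebraMap L A), eval_map, aeval_def]

theorem eval_pderiv_form (x : Fin 3 → A) (a : Idx d → A) (i : Fin 3) :
    eval x (pderiv i (form d a)) = ∑ p, aeval x (pderiv i (basisMonomial L p)) * a p := by
  rw [form_eq_sum, map_sum, map_sum]
  refine Finset.sum_congr rfl fun p _ => ?_
  rw [pderiv_C_mul, map_mul, eval_C, mul_comm, ← map_basisMonomial (algebraMap L A),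
    pderiv_map, eval_map, aeval_def]

end Forms

theorem _root_.MvPolynomial.IsHomogeneous.eval_mul {σ K : Type*} [Fintype σ] [CommSemiring K]
    {F : MvPolynomial σ K} {n : ℕ} (hF : F.IsHomogeneous n) (x : σ → K) (t : K) :
    eval (fun i => x i * t) F = eval x F * t ^ n := by
  rw [eval_eq', eval_eq', Finset.sum_mul]
  refine Finset.sum_congr rfl fun m hm => ?_
  have hdeg := hF (mem_support_iff.mp hm)
  rw [Finsupp.weight_apply, Finsupp.sum_fintype _ _ (by simp)] at hdeg
  simp only [Pi.one_apply, smul_eq_mul, mul_one] at hdeg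
  rw [← hdeg, ← Finset.prod_pow_eq_pow_sum, mul_assoc, ← Finset.prod_mul_distrib]
  simp only [mul_pow]

/-! ### The generic curve on the cone -/

section Generic

variable {L E : Type*} [Field L] [PerfectField L] [Field E] [Algebra L E]

/-- At a common zero `x` of `G` and of the form with coefficients `a`, the gradients of the two forms
are linearly independent as soon as `a` and some coordinate `x k` are algebraically independent. -/
theorem exists_minor_ne_zero {d e : ℕ} (hd : d ≠ 0) {x : Fin 3 → E} {k : Fin 3}
    {a : Idx d → E} (hw : AlgebraicIndependent L (Sum.elim (fun _ : Unit => x k) a))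
    {G : MvPolynomial (Fin 3) L} (hGe : G.IsHomogeneous e) (hG : Squarefree G)
    (hGx : aeval x G = 0) (hFx : eval x (form d a) = 0) :
    ∃ i j, eval x (pderiv i (form d a)) * aeval x (pderiv j G) ≠
      eval x (pderiv j (form d a)) * aeval x (pderiv i G) := by
  have hk : Transcendental L (x k) := hw.transcendental (.inl ())
  have hk0 : x k ≠ 0 := hw.ne_zero (.inl ())
  obtain ⟨q, hq⟩ := exists_basisMonomial_eq_X_pow (R := L) (d := d) k
  have hqx : aeval x (basisMonomial L q) ≠ 0 := by simp [hq, hk0]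
  rw [eval_form (L := L)] at hFx
  by_cases hsing : ∀ i, aeval x (pderiv i G) = 0
  · refine absurd hFx (sum_mul_ne_zero hw (fun p => aeval_mem_algClosureOf ?_ _) hqx)
    exact mem_algClosureOf_singleton hk fun m hm =>
      (exists_aeval_pderiv_ne_zero_of_squarefree hm hG hGx).elim fun i hi => hi (hsing i)
  have heuler := congrArg (aeval x) hGe.sum_X_mul_pderiv
  simp only [map_sum, map_mul, aeval_X, map_nsmul, hGx, smul_zero] at heuler
  -- By Euler's identity, the gradient of `G` cannot be concentrated in the coordinate `k`.
  obtain ⟨m, hmk, hm⟩ : ∃ m, m ≠ k ∧ aeval x (pderiv m G) ≠ 0 := by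
    by_contra! h
    rw [Finset.sum_eq_single k (fun i _ hi => by rw [h i hi, mul_zero]) (by simp)] at heuler
    have hgk := (mul_eq_zero.mp heuler).resolve_left hk0
    refine hsing fun i => ?_
    by_cases hi : i = k
    · rw [hi, hgk]
    · exact h i hi
  obtain ⟨j, hjk, hjm, -⟩ := exists_third hmk
  refine ⟨j, m, fun hminor => ?_⟩
  obtain ⟨z, hz⟩ := exists_mem_algClosureOf_pair hk fun hind =>
    hG.ne_zero ((algebraicIndependent_iff.mp hind) G hGx)
  obtain ⟨q', hq'⟩ := exists_basisMonomial_eq_X_pow_mul_X (R := L) hjk hd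
  rw [eval_pderiv_form (L := L), eval_pderiv_form (L := L), ← sub_eq_zero, Finset.sum_mul,
    Finset.sum_mul, ← Finset.sum_sub_distrib] at hminor
  -- At `X k ^ d` the multiplier `c'` of the minor is zero, and at `X k ^ (d - 1) * X j` it is
  -- `x k ^ (d - 1)` times the derivative of `G` along `X m`.
  refine sum_mul_ne_zero_of_sum_mul_eq_zero hw (q := q) (q' := q') (z := z)
    (c' := fun p => aeval x (pderiv j (basisMonomial L p) * pderiv m G -
      pderiv m (basisMonomial L p) * pderiv j G))
    (fun p => aeval_mem_algClosureOf hz _) (fun p => aeval_mem_algClosureOf hz _)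
    hqx ?_ ?_ hFx ?_
  · simp [hq', pderiv_X_of_ne hjk.symm, pderiv_X_of_ne hmk.symm, pderiv_X_of_ne hjm,
      hk0, hm]
  · simp [hq, pderiv_X_of_ne hjk.symm, pderiv_X_of_ne hmk.symm]
  · rw [← hminor]
    refine Finset.sum_congr rfl fun p _ => ?_
    simp only [map_sub, map_mul]
    ring

end Generic

/-! ### Transversality -/

section Tangent

variable {K : Type*} [Field K]

/-- A nonzero minor of the gradients also separates the tangent lines: the point with coordinates
`G_j` at `i` and `-G_i` at `j` is on the tangent line of `G` but not on that of `F`. -/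
theorem transversalAt_of_minor_ne_zero {F G : MvPolynomial (Fin 3) K} {P : Plane K}
    (hF : P ∈ points F) (hG : P ∈ points G) {i j : Fin 3}
    (h : grad F P i * grad G P j ≠ grad F P j * grad G P i) : TransversalAt F G P := by
  refine ⟨⟨hF, fun h0 => h (by simp [h0])⟩, ⟨hG, fun h0 => h (by simp [h0])⟩, fun heq => ?_⟩
  have hij : i ≠ j := fun e => h (by rw [e])
  let v : Fin 3 → K := Pi.single i (grad G P j) - Pi.single j (grad G P i)
  have hdot (H : MvPolynomial (Fin 3) K) : ∑ n, grad H P n * v n =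
      grad H P i * grad G P j - grad H P j * grad G P i := by
    simp [v, mul_sub, Finset.sum_sub_distrib, Pi.single_apply]
  have hv : v ≠ 0 := by
    intro h0
    have := hdot F
    simp only [h0, Pi.zero_apply, mul_zero, Finset.sum_const_zero] at this
    exact h (sub_eq_zero.mp this.symm)
  obtain ⟨c, hc⟩ := Projectivization.exists_smul_eq_mk_rep K v hv
  have hmem (H : MvPolynomial (Fin 3) K) : Projectivization.mk K v hv ∈ tangentLine H P ↔
      grad H P i * grad G P j - grad H P j * grad G P i = 0 := by
    have : ∑ n, grad H P n * (c • v) n = c * ∑ n, grad H P n * v n := by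
      rw [Finset.mul_sum]
      refine Finset.sum_congr rfl fun n _ => ?_
      simp only [Pi.smul_apply, Units.smul_def, smul_eq_mul]
      ring
    rw [tangentLine, Set.mem_ofPred, ← hc, this, hdot]
    simp
  have hFmem := heq ▸ (hmem G).mpr (by ring)
  exact h (sub_eq_zero.mp ((hmem F).mp hFmem))

end Tangent

theorem algebraicIndependent_translate {L K ι : Type*} [Field L] [Field K] [Algebra L K]
    {u' : ι → K} (hu' : AlgebraicIndependent L u') (u : ι → L) :
    AlgebraicIndependent L fun p => algebraMap L K (u p) + u' p := by
  let φ : MvPolynomial ι L →ₐ[L] MvPolynomial ι L := aeval fun p => C (u p) + X p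
  let ψ : MvPolynomial ι L →ₐ[L] MvPolynomial ι L := aeval fun p => X p - C (u p)
  have hψ : ψ.comp φ = AlgHom.id L _ := by
    ext p : 1
    simp [φ, ψ, ← algebraMap_eq]
  have hcomp : aeval (fun p => algebraMap L K (u p) + u' p) = (aeval u').comp φ := by
    ext p : 1
    simp [φ]
  rw [algebraicIndependent_iff_injective_aeval, hcomp]
  have hφ : Function.Injective φ :=
    Function.LeftInverse.injective (g := ψ) fun F => DFunLike.congr_fun hψ F
  rw [AlgHom.coe_comp]
  exact Function.Injective.comp hu' hφ

end PlaneCurve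

open PlaneCurve in
theorem lemma4p12 {L K : Type*} [Field L] [IsAlgClosed L] [Field K] [IsAlgClosed K]
    [Algebra L K] (d e : ℕ)
    (u : PlaneCurve.Idx d → L) (hu : PlaneCurve.IsReducedCurve d u)
    (v : PlaneCurve.Idx e → L) (hv : PlaneCurve.IsReducedCurve e v)
    (u' : PlaneCurve.Idx d → K) (hu' : PlaneCurve.IsGeneric L u') :
    ∀ P ∈ PlaneCurve.points (PlaneCurve.deformedForm d u u') ∩
        PlaneCurve.points (PlaneCurve.form e (fun p => algebraMap L K (v p))),
      PlaneCurve.TransversalAt (PlaneCurve.deformedForm d u u')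
        (PlaneCurve.form e (fun p => algebraMap L K (v p))) P := by
  rintro P ⟨hF, hG⟩
  let a : Idx d → K := fun p => algebraMap L K (u p) + u' p
  have ha : AlgebraicIndependent L a := algebraicIndependent_translate hu' u
  have hFP : MvPolynomial.eval P.rep (form d a) = 0 := hF
  have hGmap : form e (fun p => algebraMap L K (v p)) =
      MvPolynomial.map (algebraMap L K) (form e v) := (map_form _ v).symm
  -- A generic form of degree `0` is a nonzero constant and has no zeros.
  have hd : d ≠ 0 := by
    rintro rfl
    let q : Idx 0 := ⟨(0, 0), Nat.le_refl 0⟩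
    have hfin := Subsingleton.elim (α := Fin 1)
    have : Subsingleton (Idx 0) := ⟨fun p q => Subtype.ext (Prod.ext (hfin _ _) (hfin _ _))⟩
    rw [form_eq_sum, Fintype.sum_subsingleton _ q] at hFP
    exact ha.ne_zero q (by simpa [basisMonomial, q] using hFP)
  obtain ⟨k, hk⟩ := Function.ne_iff.mp P.rep_nonzero
  -- `x` is a point of the cone over `P`, scaled by an element transcendental over `K`.
  let E := RatFunc K
  let t : E := RatFunc.X
  have ht : Transcendental K t := RatFunc.transcendental_X
  let x : Fin 3 → E := fun i => algebraMap K E (P.rep i) * t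
  have hxk : Transcendental K (x k) := fun h => ht <| by
    have h' := (isAlgebraic_algebraMap (R := K) (A := E) (P.rep k)⁻¹).mul h
    rwa [← mul_assoc, ← map_mul, inv_mul_cancel₀ hk, map_one, one_mul] at h'
  have hw : AlgebraicIndependent L
      (Sum.elim (fun _ : Unit => x k) (algebraMap K E ∘ a)) :=
    ha.sumElim_comp ((algebraicIndependent_unique_type_iff).mpr hxk)
  have hscale {H : MvPolynomial (Fin 3) K} {n : ℕ} (hH : H.IsHomogeneous n) :
      MvPolynomial.eval x (MvPolynomial.map (algebraMap K E) H) =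
        algebraMap K E (MvPolynomial.eval P.rep H) * t ^ n := by
    rw [(hH.map _).eval_mul, MvPolynomial.eval_map, MvPolynomial.eval₂_comp]
    rfl
  have hscale' {H : MvPolynomial (Fin 3) K} {n : ℕ} (hH : H.IsHomogeneous n) (i : Fin 3) :
      MvPolynomial.eval x (MvPolynomial.pderiv i (MvPolynomial.map (algebraMap K E) H)) =
        algebraMap K E (MvPolynomial.eval P.rep (MvPolynomial.pderiv i H)) * t ^ (n - 1) := by
    rw [MvPolynomial.pderiv_map, hscale hH.pderiv]
  have hFE : form d (algebraMap K E ∘ a) = MvPolynomial.map (algebraMap K E) (form d a) :=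
    (map_form _ a).symm
  have hGE (H : MvPolynomial (Fin 3) L) : MvPolynomial.aeval x H =
      MvPolynomial.eval x (MvPolynomial.map (algebraMap K E)
        (MvPolynomial.map (algebraMap L K) H)) := by
    rw [MvPolynomial.map_map, ← IsScalarTower.algebraMap_eq, MvPolynomial.eval_map,
      MvPolynomial.aeval_def]
  have hGhom : (MvPolynomial.map (algebraMap L K) (form e v)).IsHomogeneous e :=
    (isHomogeneous_form v).map _
  have hGP : MvPolynomial.eval P.rep (MvPolynomial.map (algebraMap L K) (form e v)) = 0 :=
    hGmap ▸ hG
  obtain ⟨i, j, hij⟩ := exists_minor_ne_zero hd hw (isHomogeneous_form v) hv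
    (by rw [hGE, hscale hGhom, hGP, map_zero, zero_mul])
    (by rw [hFE, hscale (isHomogeneous_form a), hFP, map_zero, zero_mul])
  refine transversalAt_of_minor_ne_zero hF hG (i := i) (j := j) fun h => hij ?_
  simp only [hFE, hGE, ← MvPolynomial.pderiv_map, hscale' (isHomogeneous_form a), hscale' hGhom]
  have h' : algebraMap K E _ = algebraMap K E _ := congrArg (algebraMap K E) h
  rw [hGmap, map_mul, map_mul] at h'
  simp only [grad] at h'
  change algebraMap K E (MvPolynomial.eval P.rep (MvPolynomial.pderiv i (form d a))) * _ =
    algebraMap K E (MvPolynomial.eval P.rep (MvPolynomial.pderiv j (form d a))) * _ at h'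
  linear_combination (t ^ (d - 1) * t ^ (e - 1)) * h'
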